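/- For all simple graphs $F$ and $G$ (finite or infinite), $$\operatorname{coind}(B(F\times G))=\min\{\operatorname{coind}(B(F)),\operatorname{coind}(B(G))\}.$$ Here $F\times G$ is the direct (categorical) product: its vertex set is $V(F)\times V(G)$, and $(f_1,g_1)$ and $(f_2,g_2)$ are adjacent if and only if $f_1f_2\in E(F)$ and $g_1g_2\in E(G)$. The box complex $B(G)$ is the simplicial complex whose simplices are the nonempty finite sets $A\uplus B:=A\times\{1\}\cup B\times\{2\}$ with $A,B\subseteq V(G)$ such that every vertex of $A$ is adjacent to every vertex of $B$ and, if one of $A,B$ is empty, the vertices of the other have a common neighbor. Its geometric realization (with the usual weak topology, which is the Euclidean one if $G$ is finite) is a $\mathbb Z_2$-space under the involution generated by $A\uplus B\mapsto B\uplus A$. For a $\mathbb Z_2$-space $T$, i.e. a topological space with a continuous involution, $\operatorname{coind}(T)\in\{-1,0,1,\dots\}\cup\{\infty\}$ is the supremum of the integers $h\ge -1$ for which there is a continuous map from $\mathbb S^h$ to $T$ that commutes with the involutions, where $\mathbb S^h$ is the unit sphere of $\mathbb R^{h+1}$ with the antipodal map and $\mathbb S^{-1}=\emptyset$. -/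

import Mathlib

/-! ### Spaces with an involution and their coindex -/

/-- A `ℤ₂`-space: a topological space together with a continuous involution. -/
structure Z2Space where
  carrier : Type*
  [top : TopologicalSpace carrier]
  inv : carrier → carrier
  continuous_inv : Continuous inv
  involutive_inv : Function.Involutive inv

attribute [instance] Z2Space.top

/-- A `ℤ₂`-map: a continuous map that commutes with the involutions. -/
structure Z2Map (S T : Z2Space) where
  toFun : S.carrier → T.carrier
  continuous_toFun : Continuous toFun
  map_inv : ∀ x, toFun (S.inv x) = T.inv (toFun x)

/-- The unit sphere of `ℝⁿ`, of dimension `n - 1`, with the antipodal map.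
For `n = 0` this is the empty space, the sphere of dimension `-1`. -/
noncomputable def antipodalSphere (n : ℕ) : Z2Space where
  carrier := Metric.sphere (0 : EuclideanSpace ℝ (Fin n)) 1
  inv x := -x
  continuous_inv := continuous_neg
  involutive_inv := neg_involutive

/-- The `ℤ₂`-coindex: the largest dimension `n - 1` of a sphere from which there is a `ℤ₂`-map
to `T`. It is `-1` if only the empty sphere maps to `T`, and `⊤` if there is no largest one. -/
noncomputable def coind (T : Z2Space) : EReal :=
  sSup {d : EReal | ∃ n : ℕ, Nonempty (Z2Map (antipodalSphere n) T) ∧ d = (n : EReal) - 1}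

/-! ### Geometric realization of an abstract simplicial complex -/

/-- The points of the geometric realization: formal convex combinations of vertices whose
support is a face. -/
def Realization {ι : Type*} (K : PreAbstractSimplicialComplex ι) : Type _ :=
  {p : ι →₀ ℝ // p.support ∈ K ∧ (∀ i, 0 ≤ p i) ∧ (p.sum fun _ t => t) = 1}

/-- The closed cell of the realization that belongs to a set `s` of vertices. -/
def Realization.Cell {ι : Type*} (K : PreAbstractSimplicialComplex ι) (s : Finset ι) : Type _ :=
  {p : Realization K // p.1.support ⊆ s}

/-- A closed cell carries the Euclidean topology, given by the barycentric coordinates. -/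
instance {ι : Type*} (K : PreAbstractSimplicialComplex ι) (s : Finset ι) :
    TopologicalSpace (Realization.Cell K s) :=
  TopologicalSpace.induced (fun (p : Realization.Cell K s) (i : s) => (p.1.1 i.1 : ℝ)) inferInstance

/-- The usual (weak) topology of the realization: a set is open if and only if it meets the closed
cell of every face in an open subset of that cell. -/
instance {ι : Type*} (K : PreAbstractSimplicialComplex ι) : TopologicalSpace (Realization K) :=
  ⨆ s : {s : Finset ι // s ∈ K}, TopologicalSpace.coinduced
    (fun p : Realization.Cell K s.1 => p.1) inferInstance

/-- The map of the realization that extends a simplicial permutation of the vertices. -/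
def Realization.permute {ι : Type*} {K : PreAbstractSimplicialComplex ι} (e : ι ≃ ι)
    (he : ∀ s ∈ K, s.map e.toEmbedding ∈ K) (p : Realization K) : Realization K :=
  ⟨p.1.equivMapDomain e, he _ p.2.1, fun i => p.2.2.1 (e.symm i), by
    rw [Finsupp.sum_equivMapDomain]; exact p.2.2.2⟩

theorem Realization.continuous_permute {ι : Type*} {K : PreAbstractSimplicialComplex ι} (e : ι ≃ ι)
    (he : ∀ s ∈ K, s.map e.toEmbedding ∈ K) : Continuous (Realization.permute e he) := by
  refine continuous_iSup_dom.2 fun s => continuous_coinduced_dom.2 ?_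
  let t : {s : Finset ι // s ∈ K} := ⟨s.1.map e.toEmbedding, he _ s.2⟩
  let g : Realization.Cell K s.1 → Realization.Cell K t.1 := fun p =>
    ⟨Realization.permute e he p.1, Finset.map_subset_map.2 p.2⟩
  have hg : Continuous g := by
    refine continuous_induced_rng.2 (continuous_pi fun i => ?_)
    have hi : e.symm i.1 ∈ s.1 := by
      obtain ⟨j, hj, hji⟩ := Finset.mem_map.1 i.2
      rw [← hji]
      simpa using hj
    have hd : Continuous fun (p : Realization.Cell K s.1) (j : s.1) => (p.1.1 j.1 : ℝ) :=
      continuous_induced_dom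
    exact (continuous_apply (⟨e.symm i.1, hi⟩ : {j // j ∈ s.1})).comp hd
  have ht : Continuous (fun p : Realization.Cell K t.1 => p.1) :=
    continuous_iff_coinduced_le.2 (le_iSup (fun s : {s : Finset ι // s ∈ K} =>
      TopologicalSpace.coinduced (fun p : Realization.Cell K s.1 => p.1) inferInstance) t)
  exact ht.comp hg

/-! ### Box complexes and direct products of graphs -/

/-- The simplicial complex of the box complex `B(G)`. Its vertices come from two disjoint copies of
`V`. A nonempty finite set `s = A ⊎ B` (with `A = s.toLeft` in the first copy and `B = s.toRight`
in the second) is a face if and only if every vertex of `A` is adjacent to every vertex of `B` and,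
if one of `A`, `B` is empty, the vertices of the other one have a common neighbor. -/
def boxFaces {V : Type*} (G : SimpleGraph V) : PreAbstractSimplicialComplex (V ⊕ V) where
  faces := {s | s.Nonempty ∧ (∀ a ∈ s.toLeft, ∀ b ∈ s.toRight, G.Adj a b) ∧
    (s.toRight = ∅ → ∃ w, ∀ a ∈ s.toLeft, G.Adj w a) ∧
    (s.toLeft = ∅ → ∃ w, ∀ b ∈ s.toRight, G.Adj w b)}
  isRelLowerSet_faces := by
    rintro s ⟨hs, hAB, hA, hB⟩
    refine ⟨hs, fun t hts ht => ?_⟩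
    have hl : t.toLeft ⊆ s.toLeft := Finset.toLeft_subset_toLeft hts
    have hr : t.toRight ⊆ s.toRight := Finset.toRight_subset_toRight hts
    refine ⟨ht, fun a ha b hb => hAB a (hl ha) b (hr hb), fun _ => ?_, fun _ => ?_⟩
    · rcases s.toRight.eq_empty_or_nonempty with h | ⟨b, hb⟩
      · obtain ⟨w, hw⟩ := hA h
        exact ⟨w, fun a ha => hw a (hl ha)⟩
      · exact ⟨b, fun a ha => (hAB a (hl ha) b hb).symm⟩
    · rcases s.toLeft.eq_empty_or_nonempty with h | ⟨a, ha⟩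
      · obtain ⟨w, hw⟩ := hB h
        exact ⟨w, fun b hb => hw b (hr hb)⟩
      · exact ⟨a, fun b hb => hAB a ha b (hr hb)⟩

/-- Exchanging the two copies, `A ⊎ B ↦ B ⊎ A`, preserves the faces. -/
theorem map_sumComm_mem_boxFaces {V : Type*} (G : SimpleGraph V) :
    ∀ s ∈ boxFaces G, s.map (Equiv.sumComm V V).toEmbedding ∈ boxFaces G := by
  rintro s ⟨hs, hAB, hA, hB⟩
  have hl : (s.map (Equiv.sumComm V V).toEmbedding).toLeft = s.toRight := by
    ext x; simp
  have hr : (s.map (Equiv.sumComm V V).toEmbedding).toRight = s.toLeft := by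
    ext x; simp
  refine ⟨hs.map, ?_, ?_, ?_⟩
  · rw [hl, hr]
    exact fun a ha b hb => (hAB b hb a ha).symm
  · rw [hl, hr]
    exact hB
  · rw [hl, hr]
    exact hA

/-- The box complex `B(G)` as a `ℤ₂`-space: the geometric realization with the involution generated
by the simplicial map `A ⊎ B ↦ B ⊎ A`. -/
def boxComplex {V : Type*} (G : SimpleGraph V) : Z2Space where
  carrier := Realization (boxFaces G)
  inv := Realization.permute (Equiv.sumComm V V) (map_sumComm_mem_boxFaces G)
  continuous_inv := Realization.continuous_permute _ _
  involutive_inv := fun p => by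
    apply Subtype.ext
    ext i
    simp [Realization.permute, Finsupp.equivMapDomain_apply]

/-- The direct (categorical) product of two graphs. -/
def directProduct {V W : Type*} (F : SimpleGraph V) (G : SimpleGraph W) :
    SimpleGraph (V × W) where
  Adj x y := F.Adj x.1 y.1 ∧ G.Adj x.2 y.2
  symm := ⟨fun _ _ h => ⟨h.1.symm, h.2.symm⟩⟩
  loopless := ⟨fun _ h => h.1.ne rfl⟩

/-! ### Continuity into and out of the realization -/

/-! The projections are graph homomorphisms and induce `ℤ₂`-maps of box complexes
(`nonempty_z2Map_of_hom`); this gives `≤`. For `≥`, two `ℤ₂`-maps from one sphere to `B(F)` and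
`B(G)` must be combined. Multiplying barycentric coordinates copy by copy turns sides `A`, `A'` into
`A × A'`, which suits adjacency in the product, but everything may vanish where the two maps have
opposite sides empty.

So each map is first replaced by a `JoinedWeight`, where both sides are nonempty everywhere
(`nonempty_joinedWeight`). Compactness of the sphere leaves finitely many vertices. Small
coordinates are cut off, and the lighter side receives common neighbors of sets `A` lying between
the large vertices and the support of the heavier side. They are adjacent to all that survives
there, and only the strictly lighter side receives any. Products of such weights are again such
weights, and normalizing gives the map (`JoinedWeight.toZ2Map`). -/

theorem Realization.continuous_cell_val {ι : Type*} {K : PreAbstractSimplicialComplex ι}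
    {s : Finset ι} (hs : s ∈ K) : Continuous (fun p : Realization.Cell K s => p.1) :=
  continuous_iff_coinduced_le.2 (le_iSup (fun s : {s : Finset ι // s ∈ K} =>
    TopologicalSpace.coinduced (fun p : Realization.Cell K s.1 => p.1) inferInstance) ⟨s, hs⟩)

theorem Realization.continuous_coord {ι : Type*} (K : PreAbstractSimplicialComplex ι) (i : ι) :
    Continuous (fun p : Realization K => (p.1 i : ℝ)) := by
  refine continuous_iSup_dom.2 fun s => continuous_coinduced_dom.2 ?_
  by_cases hi : i ∈ s.1
  · have hd : Continuous fun (p : Realization.Cell K s.1) (j : s.1) => (p.1.1 j.1 : ℝ) :=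
      continuous_induced_dom
    exact (continuous_apply (⟨i, hi⟩ : {j // j ∈ s.1})).comp hd
  · have h : ((fun p : Realization K => (p.1 i : ℝ)) ∘ fun p : Realization.Cell K s.1 => p.1)
        = fun _ => 0 :=
      funext fun p => Finsupp.notMem_support_iff.1 fun h => hi (p.2 h)
    rw [h]
    exact continuous_const

/-- A set is closed in the realization as soon as it has finitely many points in each cell. -/
theorem Realization.isClosed_of_finite_inter {ι : Type*} {K : PreAbstractSimplicialComplex ι}
    {D : Set (Realization K)}
    (hD : ∀ s : Finset ι, {p : Realization K | p ∈ D ∧ p.1.support ⊆ s}.Finite) : IsClosed D := by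
  refine isClosed_iSup_iff.2 fun s => isClosed_coinduced.2 ?_
  have : T1Space (Realization.Cell K s.1) := by
    refine t1Space_of_injective_of_continuous
      (f := fun (p : Realization.Cell K s.1) (j : s.1) => (p.1.1 j.1 : ℝ)) ?_ continuous_induced_dom
    intro p q hpq
    refine Subtype.ext (Subtype.ext (Finsupp.ext fun i => ?_))
    by_cases hi : i ∈ s.1
    · exact congrFun hpq ⟨i, hi⟩
    · rw [Finsupp.notMem_support_iff.1 fun h => hi (p.2 h),
        Finsupp.notMem_support_iff.1 fun h => hi (q.2 h)]
  refine Set.Finite.isClosed ?_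
  refine ((hD s.1).preimage (f := fun p : Realization.Cell K s.1 => p.1)
    Subtype.val_injective.injOn).subset fun p hp => ⟨hp, p.2⟩

/-- A compact subset of the realization involves only finitely many vertices. -/
theorem Realization.finite_vertices_of_isCompact {ι : Type*} {K : PreAbstractSimplicialComplex ι}
    {C : Set (Realization K)} (hC : IsCompact C) : {i : ι | ∃ p ∈ C, p.1 i ≠ 0}.Finite := by
  set U := {i : ι | ∃ p ∈ C, p.1 i ≠ 0}
  -- If `q i` lies in the cell of `s`, then `i ∈ s`. So every subset of the range of `q` meets each
  -- cell in a finite set and is closed; the range is discrete and compact, hence finite.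
  choose q hqC hq using fun i : U => i.2
  have hclosed : ∀ D ⊆ Set.range q, IsClosed D := by
    intro D hDU
    refine Realization.isClosed_of_finite_inter fun s => ?_
    refine ((s.finite_toSet.preimage (f := (Subtype.val : U → ι))
      Subtype.val_injective.injOn).image q).subset ?_
    rintro p ⟨hp, hps⟩
    obtain ⟨i, rfl⟩ := hDU hp
    exact ⟨i, hps (Finsupp.mem_support_iff.2 (hq i)), rfl⟩
  have hdisc : DiscreteTopology (Set.range q) := by
    refine discreteTopology_iff_forall_isClosed.2 fun D => ?_
    have := (hclosed (Subtype.val '' D) (by rintro _ ⟨x, -, rfl⟩; exact x.2)).preimage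
      (continuous_subtype_val (p := fun x => x ∈ Set.range q))
    rwa [Set.preimage_image_eq _ Subtype.val_injective] at this
  have hcomp : IsCompact (Set.range q) := by
    refine hC.of_isClosed_subset (hclosed _ subset_rfl) ?_
    rintro _ ⟨i, rfl⟩
    exact hqC i
  have hfin : (Set.range q).Finite := hcomp.finite (isDiscrete_iff_discreteTopology.2 hdisc)
  refine (hfin.biUnion (t := fun p => (p.1.support : Set ι))
    fun p _ => p.1.support.finite_toSet).subset fun i hi => ?_
  exact Set.mem_biUnion ⟨⟨i, hi⟩, rfl⟩ (Finsupp.mem_support_iff.2 (hq ⟨i, hi⟩))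

/-- A map to the realization with continuous barycentric coordinates that involves only finitely
many vertices is continuous. -/
theorem Realization.continuous_of_coord {ι X : Type*} [TopologicalSpace X]
    {K : PreAbstractSimplicialComplex ι} (T : Finset ι) (h : X → Realization K)
    (hT : ∀ x, (h x).1.support ⊆ T) (hc : ∀ i, Continuous fun x => ((h x).1 i : ℝ)) :
    Continuous h := by
  classical
  let J := {s : Finset ι // s ∈ T.powerset ∧ s ∈ K}
  have : Finite J := Finite.of_injective (fun s : J => (⟨s.1, s.2.1⟩ : T.powerset))
    fun a b hab => Subtype.ext (congrArg (fun z => z.1) hab)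
  -- The faces inside `T` give a finite closed cover of `X`, and on each piece `h` factors through
  -- one Euclidean cell.
  refine (locallyFinite_of_finite fun s : J => {x | (h x).1.support ⊆ s.1}).continuous ?_ ?_ ?_
  · refine Set.eq_univ_of_forall fun x => Set.mem_iUnion.2 ?_
    exact ⟨⟨(h x).1.support, Finset.mem_powerset.2 (hT x), (h x).2.1⟩, Finset.Subset.refl _⟩
  · intro s
    have : {x | (h x).1.support ⊆ s.1} = ⋂ i, ⋂ (_ : i ∉ s.1), {x | (h x).1 i = 0} := by
      ext x
      simp only [Set.mem_ofPred_eq, Set.mem_iInter, Finset.subset_iff, Finsupp.mem_support_iff]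
      exact forall_congr' fun i => ⟨fun hi hn => by_contra fun h0 => hn (hi h0),
        fun hi h0 => by_contra fun hn => h0 (hi hn)⟩
    rw [this]
    exact isClosed_iInter fun i => isClosed_iInter fun _ => isClosed_eq (hc i) continuous_const
  · intro s
    rw [continuousOn_iff_continuous_domRestrict]
    let g : {x | (h x).1.support ⊆ s.1} → Realization.Cell K s.1 := fun x => ⟨h x.1, x.2⟩
    have hg : Continuous g :=
      continuous_induced_rng.2 (continuous_pi fun i => (hc i.1).comp continuous_subtype_val)
    exact (Realization.continuous_cell_val s.2.2).comp hg

/-! ### Weights: maps to the pairs of nonempty, completely joined vertex sets -/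

/-- Continuous finitely supported weights on the vertices of `G`, such that the supports at a point
and at its image under the involution are nonempty and completely joined. -/
structure JoinedWeight {V : Type*} (S : Z2Space) (G : SimpleGraph V) where
  wt : S.carrier → V → ℝ
  continuous_wt : ∀ v, Continuous fun s => wt s v
  nonneg : ∀ s v, 0 ≤ wt s v
  verts : Finset V
  mem_verts : ∀ s v, 0 < wt s v → v ∈ verts
  exists_pos : ∀ s, ∃ v, 0 < wt s v
  adj : ∀ s a b, 0 < wt s a → 0 < wt (S.inv s) b → G.Adj a b

theorem JoinedWeight.wt_eq_zero {V : Type*} {S : Z2Space} {G : SimpleGraph V}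
    (x : JoinedWeight S G) {s : S.carrier} {v : V} (hv : v ∉ x.verts) : x.wt s v = 0 :=
  le_antisymm (not_lt.1 fun h => hv (x.mem_verts s v h)) (x.nonneg s v)

/-- The product of weights. -/
def JoinedWeight.prod {V W : Type*} {S : Z2Space} {F : SimpleGraph V} {G : SimpleGraph W}
    (x : JoinedWeight S F) (y : JoinedWeight S G) : JoinedWeight S (directProduct F G) where
  wt s v := x.wt s v.1 * y.wt s v.2
  continuous_wt v := (x.continuous_wt v.1).mul (y.continuous_wt v.2)
  nonneg s v := mul_nonneg (x.nonneg s v.1) (y.nonneg s v.2)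
  verts := x.verts ×ˢ y.verts
  mem_verts s v h := Finset.mem_product.2
    ⟨x.mem_verts s _ (pos_of_mul_pos_left h (y.nonneg s _)),
      y.mem_verts s _ (pos_of_mul_pos_right h (x.nonneg s _))⟩
  exists_pos s := by
    obtain ⟨v, hv⟩ := x.exists_pos s
    obtain ⟨w, hw⟩ := y.exists_pos s
    exact ⟨(v, w), mul_pos hv hw⟩
  adj s a b ha hb :=
    ⟨x.adj s _ _ (pos_of_mul_pos_left ha (y.nonneg _ _)) (pos_of_mul_pos_left hb (y.nonneg _ _)),
     y.adj s _ _ (pos_of_mul_pos_right ha (x.nonneg _ _)) (pos_of_mul_pos_right hb (x.nonneg _ _))⟩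

namespace JoinedWeight

variable {V : Type*} {S : Z2Space} {G : SimpleGraph V}

/-- The total weight at a point and at its image under the involution. -/
noncomputable def total (x : JoinedWeight S G) (s : S.carrier) : ℝ :=
  ∑ v ∈ x.verts, x.wt s v + ∑ v ∈ x.verts, x.wt (S.inv s) v

theorem total_pos (x : JoinedWeight S G) (s : S.carrier) : 0 < x.total s := by
  obtain ⟨v, hv⟩ := x.exists_pos s
  exact add_pos_of_pos_of_nonneg
    (Finset.sum_pos' (fun v _ => x.nonneg s v) ⟨v, x.mem_verts s v hv, hv⟩)
    (Finset.sum_nonneg fun v _ => x.nonneg _ v)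

theorem total_inv (x : JoinedWeight S G) (s : S.carrier) : x.total (S.inv s) = x.total s := by
  rw [total, total, S.involutive_inv s, add_comm]

theorem continuous_total (x : JoinedWeight S G) : Continuous x.total :=
  (continuous_finsetSum _ fun v _ => x.continuous_wt v).add
    (continuous_finsetSum _ fun v _ => (x.continuous_wt v).comp S.continuous_inv)

/-- The barycentric coordinates of the point of the box complex given by a weight. -/
noncomputable def coord (x : JoinedWeight S G) (s : S.carrier) : V ⊕ V → ℝ :=
  Sum.elim (fun v => x.wt s v / x.total s) fun v => x.wt (S.inv s) v / x.total s

theorem coord_nonneg (x : JoinedWeight S G) (s : S.carrier) (i : V ⊕ V) : 0 ≤ x.coord s i := by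
  rcases i with v | v
  · exact div_nonneg (x.nonneg _ _) (x.total_pos s).le
  · exact div_nonneg (x.nonneg _ _) (x.total_pos s).le

theorem mem_disjSum_of_coord_ne_zero (x : JoinedWeight S G) (s : S.carrier) (i : V ⊕ V)
    (hi : x.coord s i ≠ 0) : i ∈ x.verts.disjSum x.verts := by
  by_contra h
  refine hi ?_
  rcases i with v | v
  · rw [Finset.inl_mem_disjSum] at h
    simp [coord, x.wt_eq_zero h]
  · rw [Finset.inr_mem_disjSum] at h
    simp [coord, x.wt_eq_zero h]

/-- The barycentric coordinates as a finitely supported function. -/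
noncomputable def finsuppCoord (x : JoinedWeight S G) (s : S.carrier) : V ⊕ V →₀ ℝ :=
  Finsupp.onFinset (x.verts.disjSum x.verts) (x.coord s) (x.mem_disjSum_of_coord_ne_zero s)

theorem finsuppCoord_inl_ne_zero (x : JoinedWeight S G) {s : S.carrier} {v : V} :
    x.finsuppCoord s (Sum.inl v) ≠ 0 ↔ 0 < x.wt s v := by
  change x.wt s v / x.total s ≠ 0 ↔ _
  rw [div_ne_zero_iff, and_iff_left (x.total_pos s).ne', (x.nonneg s v).lt_iff_ne, ne_comm]

theorem finsuppCoord_inr_ne_zero (x : JoinedWeight S G) {s : S.carrier} {v : V} :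
    x.finsuppCoord s (Sum.inr v) ≠ 0 ↔ 0 < x.wt (S.inv s) v := by
  change x.wt (S.inv s) v / x.total s ≠ 0 ↔ _
  rw [div_ne_zero_iff, and_iff_left (x.total_pos s).ne', (x.nonneg _ v).lt_iff_ne, ne_comm]

/-- Both sides are nonempty, so the common-neighbor conditions are vacuous. -/
theorem support_finsuppCoord_mem (x : JoinedWeight S G) (s : S.carrier) :
    (x.finsuppCoord s).support ∈ boxFaces G := by
  obtain ⟨a, ha⟩ := x.exists_pos s
  obtain ⟨b, hb⟩ := x.exists_pos (S.inv s)
  refine ⟨⟨Sum.inl a, Finsupp.mem_support_iff.2 (x.finsuppCoord_inl_ne_zero.2 ha)⟩, ?_, ?_, ?_⟩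
  · intro a ha b hb
    rw [Finset.mem_toLeft, Finsupp.mem_support_iff, finsuppCoord_inl_ne_zero] at ha
    rw [Finset.mem_toRight, Finsupp.mem_support_iff, finsuppCoord_inr_ne_zero] at hb
    exact x.adj s a b ha hb
  · intro h
    refine absurd h (Finset.Nonempty.ne_empty ⟨b, ?_⟩)
    rwa [Finset.mem_toRight, Finsupp.mem_support_iff, finsuppCoord_inr_ne_zero]
  · intro h
    refine absurd h (Finset.Nonempty.ne_empty ⟨a, ?_⟩)
    rwa [Finset.mem_toLeft, Finsupp.mem_support_iff, finsuppCoord_inl_ne_zero]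

theorem sum_finsuppCoord (x : JoinedWeight S G) (s : S.carrier) :
    ((x.finsuppCoord s).sum fun _ t => t) = 1 := by
  rw [finsuppCoord, Finsupp.onFinset_sum _ fun _ => rfl, Finset.sum_disjSum]
  simp only [coord, Sum.elim_inl, Sum.elim_inr]
  rw [← Finset.sum_div, ← Finset.sum_div, ← add_div]
  exact div_self (x.total_pos s).ne'

/-- A weight induces a `ℤ₂`-map to the box complex. -/
noncomputable def toZ2Map (x : JoinedWeight S G) : Z2Map S (boxComplex G) where
  toFun s := (⟨x.finsuppCoord s, x.support_finsuppCoord_mem s, x.coord_nonneg s,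
    x.sum_finsuppCoord s⟩ : Realization (boxFaces G))
  continuous_toFun := by
    refine Realization.continuous_of_coord (K := boxFaces G) (x.verts.disjSum x.verts) _

      (fun s => Finsupp.support_onFinset_subset (hf := x.mem_disjSum_of_coord_ne_zero s)) ?_
    rintro (v | v)
    · exact (x.continuous_wt v).div x.continuous_total fun s => (x.total_pos s).ne'
    · exact ((x.continuous_wt v).comp S.continuous_inv).div x.continuous_total
        fun s => (x.total_pos s).ne'
  map_inv s := by
    refine Subtype.ext (Finsupp.ext ?_)
    rintro (v | v)
    · change x.wt (S.inv s) v / x.total (S.inv s) = x.wt (S.inv s) v / x.total s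
      rw [total_inv]
    · change x.wt (S.inv (S.inv s)) v / x.total (S.inv s) = x.wt s v / x.total s
      rw [total_inv, S.involutive_inv s]

end JoinedWeight

/-- A `ℤ₂`-map from a compact space to the box complex can be pushed away from the two subcomplexes
with an empty side: on the side that carries more weight, the small coordinates are cut off, and the
other side receives common neighbors of the sets of vertices that contain all the large ones. -/
theorem nonempty_joinedWeight {V : Type*} {S : Z2Space} [CompactSpace S.carrier]
    {G : SimpleGraph V} (f : Z2Map S (boxComplex G)) : Nonempty (JoinedWeight S G) := by
  classical
  -- For the empty sphere `V` may be empty, leaving no default value for `w` below.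
  rcases isEmpty_or_nonempty S.carrier with hS | ⟨⟨s₀⟩⟩
  · exact ⟨⟨fun s => hS.elim s, fun v => continuous_iff_continuousAt.2 fun s => hS.elim s,
      fun s => hS.elim s, ∅, fun s => hS.elim s, fun s => hS.elim s, fun s => hS.elim s⟩⟩
  let P : S.carrier → Realization (boxFaces G) := f.toFun
  have hP : Continuous P := f.continuous_toFun
  have hV : Nonempty V := by
    obtain ⟨i, -⟩ := (P s₀).2.1.1
    exact ⟨i.elim id id⟩
  obtain ⟨w, hw⟩ : ∃ w : Finset V → V, ∀ A z, (∀ a ∈ A, G.Adj z a) → ∀ a ∈ A, G.Adj (w A) a := by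
    have : ∀ A : Finset V, ∃ y, ∀ z, (∀ a ∈ A, G.Adj z a) → ∀ a ∈ A, G.Adj y a := by
      intro A
      by_cases h : ∃ z, ∀ a ∈ A, G.Adj z a
      · exact ⟨h.choose, fun _ _ => h.choose_spec⟩
      · exact ⟨hV.some, fun z hz => absurd ⟨z, hz⟩ h⟩
    exact ⟨fun A => (this A).choose, fun A => (this A).choose_spec⟩
  let x : S.carrier → V → ℝ := fun s v => (P s).1 (Sum.inl v)
  have hx0 : ∀ s v, 0 ≤ x s v := fun s v => (P s).2.2.1 _
  have hxc : ∀ v, Continuous fun s => x s v := fun v => (Realization.continuous_coord _ _).comp hP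
  -- By equivariance `x` alone encodes both sides.
  have hxi : ∀ s v, x (S.inv s) v = (P s).1 (Sum.inr v) := fun s v => by
    change (f.toFun (S.inv s)).1 (Sum.inl v) = _
    rw [f.map_inv]
    rfl
  obtain ⟨T, hT⟩ : ∃ T : Finset V, ∀ s v, 0 < x s v → v ∈ T := by
    have hfin := (Realization.finite_vertices_of_isCompact (isCompact_range hP)).preimage
      (f := Sum.inl) Sum.inl_injective.injOn
    exact ⟨hfin.toFinset, fun s v h => hfin.mem_toFinset.2 ⟨P s, ⟨s, rfl⟩, h.ne'⟩⟩
  have hadj : ∀ s a b, 0 < x s a → 0 < x (S.inv s) b → G.Adj a b := by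
    intro s a b ha hb
    rw [hxi] at hb
    exact (P s).2.1.2.1 a (by simpa using ha.ne') b (by simpa using hb.ne')
  have hne : ∀ s, (∃ a, 0 < x s a) ∨ ∃ b, 0 < x (S.inv s) b := by
    intro s
    obtain ⟨a | b, h⟩ := (P s).2.1.1
    · exact Or.inl ⟨a, (hx0 s a).lt_of_ne (Finsupp.mem_support_iff.1 h).symm⟩
    · refine Or.inr ⟨b, (hx0 _ b).lt_of_ne ?_⟩
      rw [hxi]
      exact (Finsupp.mem_support_iff.1 h).symm
  have hcn : ∀ s, ∃ z, ∀ a, 0 < x s a → G.Adj z a := by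
    intro s
    by_cases h : ∃ b, 0 < x (S.inv s) b
    · obtain ⟨b, hb⟩ := h
      exact ⟨b, fun a ha => (hadj s a b ha hb).symm⟩
    · obtain ⟨z, hz⟩ := (P s).2.1.2.2.1 (Finset.eq_empty_of_forall_notMem fun b hb => h ⟨b, by
        rw [hxi]
        exact ((P s).2.2.1 _).lt_of_ne (by simpa using hb : _ ≠ _).symm⟩)
      exact ⟨z, fun a ha => hz a (by simpa using ha.ne')⟩
  let σ : S.carrier → ℝ := fun s => ∑ v ∈ T, x s v
  -- The `+ 1` puts the threshold strictly below the average over `T` when `σ s > 0`, so some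
  -- coordinate survives the cut.
  let τ : S.carrier → ℝ := fun s => σ s / (T.card + 1)
  -- For `A ⊆ T`, positive exactly when `A` lies in the support of `x s` and contains every vertex
  -- of `T` with coordinate at least `τ s`.
  let l : S.carrier → Finset V → ℝ := fun s A =>
    (∏ a ∈ A, x s a) * ∏ a ∈ T \ A, max (τ s - x s a) 0
  have hσc : Continuous σ := continuous_finsetSum _ fun v _ => hxc v
  have hτc : Continuous τ := hσc.div_const _
  have hlc : ∀ A, Continuous fun s => l s A := fun A =>
    (continuous_finsetProd _ fun v _ => hxc v).mul
      (continuous_finsetProd _ fun v _ => (hτc.sub (hxc v)).max continuous_const)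
  have hσ0 : ∀ s, 0 ≤ σ s := fun s => Finset.sum_nonneg fun v _ => hx0 s v
  have hτ0 : ∀ s, 0 ≤ τ s := fun s => div_nonneg (hσ0 s) (by positivity)
  have hl0 : ∀ s A, 0 ≤ l s A := fun s A =>
    mul_nonneg (Finset.prod_nonneg fun v _ => hx0 s v)
      (Finset.prod_nonneg fun v _ => le_max_right _ _)
  have hσpos : ∀ s a, 0 < x s a → 0 < σ s := fun s a ha =>
    Finset.sum_pos' (fun v _ => hx0 s v) ⟨a, hT s a ha, ha⟩
  have hlarge : ∀ s, 0 < σ s → ∃ a, τ s < x s a := by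
    intro s hs
    by_contra! h
    have h1 : σ s ≤ T.card * τ s := by
      simpa using Finset.sum_le_card_nsmul T (x s) (τ s) fun v _ => h v
    have h2 : 0 < τ s := div_pos hs (by positivity)
    have h3 : τ s * (T.card + 1) = σ s := div_mul_cancel₀ _ (by positivity)
    linarith
  have hlpos : ∀ s A, A ∈ T.powerset → 0 < l s A →
      (∀ a ∈ A, 0 < x s a) ∧ ∀ a, τ s < x s a → a ∈ A := by
    intro s A _ h
    refine ⟨fun a ha => (hx0 s a).lt_of_ne fun h0 => ?_, fun a ha => by_contra fun hn => ?_⟩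
    · exact h.ne' (mul_eq_zero_of_left (Finset.prod_eq_zero ha h0.symm) _)
    · refine h.ne' (mul_eq_zero_of_right _ (Finset.prod_eq_zero (i := a) ?_ ?_))
      · exact Finset.mem_sdiff.2 ⟨hT s a ((hτ0 s).trans_lt ha), hn⟩
      · exact max_eq_right (by linarith)
  have hlex : ∀ s, 0 < σ s → ∃ A ∈ T.powerset, 0 < l s A := by
    intro s hs
    refine ⟨T.filter fun a => 0 < x s a, by simp, mul_pos ?_ ?_⟩
    · exact Finset.prod_pos fun a ha => (Finset.mem_filter.1 ha).2
    · refine Finset.prod_pos fun a ha => lt_max_of_lt_left ?_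
      have h0 : x s a ≤ 0 := by
        by_contra! h
        simp_all
      have h2 : 0 < τ s := div_pos hs (by positivity)
      linarith
  have hadjw : ∀ s A a, A ∈ T.powerset → 0 < l s A → τ s < x s a → G.Adj (w A) a := by
    intro s A a hA h ha
    obtain ⟨h1, h2⟩ := hlpos s A hA h
    obtain ⟨z, hz⟩ := hcn s
    exact hw A z (fun a ha => hz a (h1 a ha)) a (h2 a ha)
  -- The factor `max (σ (S.inv s) - σ s) 0` adds neighbors only on the strictly lighter side, so two
  -- added vertices never have to be adjacent.
  let y : S.carrier → V → ℝ := fun s v => max (x s v - τ s) 0 +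
    max (σ (S.inv s) - σ s) 0 * ∑ A ∈ T.powerset with w A = v, l (S.inv s) A
  have hyne : ∀ s v, 0 < y s v → τ s < x s v ∨
      (σ s < σ (S.inv s) ∧ ∃ A ∈ T.powerset, w A = v ∧ 0 < l (S.inv s) A) := by
    intro s v h
    by_contra! hn
    obtain ⟨h1, h2⟩ := hn
    refine h.ne' ?_
    have e1 : max (x s v - τ s) 0 = 0 := max_eq_right (by linarith)
    rcases lt_or_ge (σ s) (σ (S.inv s)) with h3 | h3
    · have e2 : ∑ A ∈ T.powerset with w A = v, l (S.inv s) A = 0 :=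
        Finset.sum_eq_zero fun A hA => le_antisymm
          (h2 h3 A (Finset.mem_filter.1 hA).1 (Finset.mem_filter.1 hA).2) (hl0 _ A)
      simp only [y, e1, e2, mul_zero, add_zero]
    · have e2 : max (σ (S.inv s) - σ s) 0 = 0 := max_eq_right (by linarith)
      simp only [y, e1, e2, zero_mul, add_zero]
  refine ⟨⟨y, ?_, ?_, T ∪ T.powerset.image w, ?_, ?_, ?_⟩⟩
  · intro v
    refine (((hxc v).sub hτc).max continuous_const).add
      ((((hσc.comp S.continuous_inv).sub hσc).max continuous_const).mul ?_)
    exact continuous_finsetSum _ fun A _ => (hlc A).comp S.continuous_inv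
  · exact fun s v => add_nonneg (le_max_right _ _)
      (mul_nonneg (le_max_right _ _) (Finset.sum_nonneg fun A _ => hl0 _ A))
  · intro s v h
    rw [Finset.mem_union, Finset.mem_image]
    rcases hyne s v h with h | ⟨-, A, hA, hv, -⟩
    · exact Or.inl (hT s v ((hτ0 s).trans_lt h))
    · exact Or.inr ⟨A, hA, hv⟩
  · intro s
    rcases (hσ0 s).lt_or_eq with hs | hs
    · obtain ⟨a, ha⟩ := hlarge s hs
      exact ⟨a, add_pos_of_pos_of_nonneg (lt_max_of_lt_left (sub_pos.2 ha))
        (mul_nonneg (le_max_right _ _) (Finset.sum_nonneg fun A _ => hl0 _ A))⟩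
    · have hs' : 0 < σ (S.inv s) := by
        rcases hne s with ⟨a, ha⟩ | ⟨b, hb⟩
        · exact absurd hs (hσpos s a ha).ne
        · exact hσpos _ b hb
      obtain ⟨A, hA, hl⟩ := hlex _ hs'
      refine ⟨w A, add_pos_of_nonneg_of_pos (le_max_right _ _) (mul_pos ?_ ?_)⟩
      · exact lt_max_of_lt_left (by linarith)
      · exact Finset.sum_pos' (fun A _ => hl0 _ A) ⟨A, Finset.mem_filter.2 ⟨hA, rfl⟩, hl⟩
  · intro s a b ha hb
    have hii : S.inv (S.inv s) = s := S.involutive_inv s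
    rcases hyne s a ha with ha | ⟨hs, A, hA, rfl, hl⟩ <;>
      rcases hyne _ b hb with hb | ⟨hs', B, hB, rfl, hl'⟩
    · exact hadj s a b ((hτ0 _).trans_lt ha) ((hτ0 _).trans_lt hb)
    · rw [hii] at hl'
      exact (hadjw s B a hB hl' ha).symm
    · exact hadjw _ A b hA hl hb
    · rw [hii] at hs'
      exact absurd hs hs'.not_gt

/-! ### Graph homomorphisms and spheres -/

/-- A graph homomorphism induces a `ℤ₂`-map of box complexes. -/
theorem nonempty_z2Map_of_hom {V W : Type*} {F : SimpleGraph V} {G : SimpleGraph W} (φ : F →g G) :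
    Nonempty (Z2Map (boxComplex F) (boxComplex G)) := by
  classical
  have hface : ∀ s ∈ boxFaces F, s.image (Sum.map φ φ) ∈ boxFaces G := by
    rintro s ⟨hs, hAB, hA, hB⟩
    have hl : (s.image (Sum.map φ φ)).toLeft = s.toLeft.image φ := by ext x; simp
    have hr : (s.image (Sum.map φ φ)).toRight = s.toRight.image φ := by ext x; simp
    refine ⟨hs.image _, ?_, ?_, ?_⟩
    · rw [hl, hr]
      simp only [Finset.forall_mem_image]
      exact fun a ha b hb => φ.map_adj (hAB a ha b hb)
    · rw [hl, hr, Finset.image_eq_empty]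
      intro h
      obtain ⟨w, hw⟩ := hA h
      exact ⟨φ w, Finset.forall_mem_image.2 fun a ha => φ.map_adj (hw a ha)⟩
    · rw [hl, hr, Finset.image_eq_empty]
      intro h
      obtain ⟨w, hw⟩ := hB h
      exact ⟨φ w, Finset.forall_mem_image.2 fun a ha => φ.map_adj (hw a ha)⟩
  have hnn : ∀ (p : Realization (boxFaces F)) i, 0 ≤ p.1.mapDomain (Sum.map φ φ) i := by
    intro p i
    rw [Finsupp.mapDomain, Finsupp.sum_apply]
    refine Finset.sum_nonneg fun j _ => ?_
    beta_reduce
    rw [Finsupp.single_apply]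
    split_ifs
    exacts [p.2.2.1 j, le_rfl]
  -- Nonnegative coordinates cannot cancel when vertices are identified.
  have hsupp : ∀ p : Realization (boxFaces F),
      (p.1.mapDomain (Sum.map φ φ)).support = p.1.support.image (Sum.map φ φ) := by
    intro p
    refine subset_antisymm Finsupp.mapDomain_support ?_
    refine Finset.image_subset_iff.2 fun j hj => ?_
    rw [Finsupp.mem_support_iff, Finsupp.mapDomain, Finsupp.sum_apply]
    refine (Finset.sum_pos' (fun k _ => ?_) ⟨j, hj, ?_⟩).ne'
    · beta_reduce
      rw [Finsupp.single_apply]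
      split_ifs
      exacts [p.2.2.1 k, le_rfl]
    · beta_reduce
      rw [Finsupp.single_eq_same]
      exact lt_of_le_of_ne (p.2.2.1 j) (Finsupp.mem_support_iff.1 hj).symm
  let f : Realization (boxFaces F) → Realization (boxFaces G) := fun p =>
    ⟨p.1.mapDomain (Sum.map φ φ), by rw [hsupp]; exact hface _ p.2.1, hnn p, by
      rw [Finsupp.sum_mapDomain_index (fun _ => rfl) fun _ _ _ => rfl]; exact p.2.2.2⟩
  refine ⟨⟨f, ?_, ?_⟩⟩
  -- In the weak topology continuity is checked on each cell, where only finitely many vertices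
  -- occur.
  · refine continuous_iSup_dom.2 fun s => continuous_coinduced_dom.2 ?_
    refine Realization.continuous_of_coord (s.1.image (Sum.map φ φ)) _ (fun p => ?_) fun i => ?_
    · exact (hsupp p.1).trans_subset (Finset.image_subset_image p.2)
    · have : (fun p : Realization.Cell (boxFaces F) s.1 => ((f p.1).1 i : ℝ)) =
          fun p => ∑ j ∈ s.1, if Sum.map φ φ j = i then p.1.1 j else 0 := by
        funext p
        change p.1.1.mapDomain (Sum.map φ φ) i = _
        rw [Finsupp.mapDomain, Finsupp.sum_apply,
          Finsupp.sum_of_support_subset _ p.2 _ fun j _ => by simp]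
        simp only [Finsupp.single_apply]
      change Continuous (fun p : Realization.Cell (boxFaces F) s.1 => ((f p.1).1 i : ℝ))
      rw [this]
      refine continuous_finsetSum _ fun j _ => ?_
      split_ifs
      · exact (Realization.continuous_coord _ j).comp (Realization.continuous_cell_val s.2)
      · exact continuous_const
  · intro p
    refine Subtype.ext ?_
    change (Finsupp.equivMapDomain _ p.1).mapDomain _ = Finsupp.equivMapDomain _ (p.1.mapDomain _)
    rw [Finsupp.equivMapDomain_eq_mapDomain, Finsupp.equivMapDomain_eq_mapDomain,
      ← Finsupp.mapDomain_comp, ← Finsupp.mapDomain_comp]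
    congr 1
    funext j
    rcases j with j | j <;> rfl

/-- The composition of `ℤ₂`-maps. -/
def Z2Map.comp {R S T : Z2Space} (g : Z2Map S T) (f : Z2Map R S) : Z2Map R T where
  toFun := g.toFun ∘ f.toFun
  continuous_toFun := g.continuous_toFun.comp f.continuous_toFun
  map_inv x := by rw [Function.comp_apply, f.map_inv, g.map_inv, Function.comp_apply]

/-- A coordinate inclusion is a linear isometry. This restricts maps from two spheres to the smaller
one. -/
theorem nonempty_z2Map_antipodalSphere {m n : ℕ} (h : m ≤ n) :
    Nonempty (Z2Map (antipodalSphere m) (antipodalSphere n)) := by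
  let b := (EuclideanSpace.basisFun (Fin n) ℝ)
  have hb : Orthonormal ℝ (b ∘ Fin.castLE h) :=
    b.orthonormal.comp _ (Fin.castLE_injective h)
  let L : EuclideanSpace ℝ (Fin m) →ₗ[ℝ] EuclideanSpace ℝ (Fin n) :=
    (EuclideanSpace.basisFun (Fin m) ℝ).toBasis.constr ℝ (b ∘ Fin.castLE h)
  let I : EuclideanSpace ℝ (Fin m) →ₗᵢ[ℝ] EuclideanSpace ℝ (Fin n) :=
    L.isometryOfOrthonormal (v := (EuclideanSpace.basisFun (Fin m) ℝ).toBasis)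
      (by simp)
      (by
        have : L ∘ (EuclideanSpace.basisFun (Fin m) ℝ).toBasis = b ∘ Fin.castLE h := by
          funext i
          exact Module.Basis.constr_basis _ _ _ _
        rwa [this])
  refine ⟨⟨fun x => ⟨I x.1, ?_⟩, ?_, ?_⟩⟩
  · rw [mem_sphere_zero_iff_norm, I.norm_map, ← mem_sphere_zero_iff_norm]
    exact x.2
  · exact (I.continuous.comp continuous_subtype_val).subtype_mk _
  · intro x
    exact Subtype.ext (I.map_neg x.1)

/-- The coindex of a space to which exactly the spheres that map to two other spaces map. -/
theorem coind_eq_min {R S T : Z2Space}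
    (h : ∀ n, Nonempty (Z2Map (antipodalSphere n) R) ↔
      Nonempty (Z2Map (antipodalSphere n) S) ∧ Nonempty (Z2Map (antipodalSphere n) T)) :
    coind R = min (coind S) (coind T) := by
  refine le_antisymm (le_min ?_ ?_) (le_of_forall_lt fun c hc => ?_)
  · exact sSup_le_sSup fun d ⟨n, hn, hd⟩ => ⟨n, ((h n).1 hn).1, hd⟩
  · exact sSup_le_sSup fun d ⟨n, hn, hd⟩ => ⟨n, ((h n).1 hn).2, hd⟩
  · obtain ⟨h1, h2⟩ := lt_min_iff.1 hc
    obtain ⟨_, ⟨m, ⟨f⟩, rfl⟩, hm⟩ := lt_sSup_iff.1 h1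
    obtain ⟨_, ⟨n, ⟨g⟩, rfl⟩, hn⟩ := lt_sSup_iff.1 h2
    obtain ⟨i⟩ := nonempty_z2Map_antipodalSphere (min_le_left m n)
    obtain ⟨j⟩ := nonempty_z2Map_antipodalSphere (min_le_right m n)
    -- Working below an arbitrary `c` also covers infinite coindex, where no largest sphere exists.
    refine lt_of_lt_of_le ?_ (le_sSup ⟨min m n, (h _).2 ⟨⟨f.comp i⟩, ⟨g.comp j⟩⟩, rfl⟩)
    rcases min_choice m n with e | e <;> rw [e]
    exacts [hm, hn]

theorem mainTheorem5 {V W : Type*} (F : SimpleGraph V) (G : SimpleGraph W) :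
    coind (boxComplex (directProduct F G)) =
      min (coind (boxComplex F)) (coind (boxComplex G)) := by
  refine coind_eq_min fun n => ⟨fun ⟨h⟩ => ?_, fun ⟨⟨f⟩, ⟨g⟩⟩ => ?_⟩
  · obtain ⟨p⟩ := nonempty_z2Map_of_hom (F := directProduct F G) (G := F) ⟨Prod.fst, fun h => h.1⟩
    obtain ⟨q⟩ := nonempty_z2Map_of_hom (F := directProduct F G) (G := G) ⟨Prod.snd, fun h => h.2⟩
    exact ⟨⟨p.comp h⟩, ⟨q.comp h⟩⟩
  · have : CompactSpace (antipodalSphere n).carrier :=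
      inferInstanceAs (CompactSpace (Metric.sphere (0 : EuclideanSpace ℝ (Fin n)) 1))
    obtain ⟨x⟩ := nonempty_joinedWeight f
    obtain ⟨y⟩ := nonempty_joinedWeight g
    exact ⟨(x.prod y).toZ2Map⟩
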